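/- An operation on $\{0,1\}$ is a map $f:\{0,1\}^t\to\{0,1\}$ with $t\ge 1$; it acts coordinatewise on $t$-tuples of vectors in $\{0,1\}^n$. A (Boolean) clone is a set of operations that contains all projections and is closed under composition; $\langle G\rangle$ denotes the clone generated by $G$. For a set $\mathcal F$ of operations and $\mathcal S\subseteq\{0,1\}^n$, let $Cl_{\mathcal F}(\mathcal S)$ be the smallest set of vectors that contains $\mathcal S$ and is closed under the coordinatewise action of the operations in $\mathcal F$. For a fixed $\mathcal F$, the problem $\textsc{Closure}_{\mathcal F}$ is: given $n$, $m$, a vector $v\in\{0,1\}^n$ and a set $\mathcal S\subseteq\{0,1\}^n$ presented as a list of $m$ vectors, decide whether $v\in Cl_{\mathcal F}(\mathcal S)$. For $k\ge 2$ let $Th_k^{k+1}:\{0,1\}^{k+1}\to\{0,1\}$ be the threshold function that is $1$ if and only if at least $k$ of its $k+1$ arguments are $1$. Put $$S_{10}^k=\langle Th_k^{k+1},\,x\wedge(y\vee z)\rangle,\quad S_{12}^k=\langle Th_k^{k+1},\,x\wedge(y\to z)\rangle,\quad D_1=\langle maj,\,x+y+z\rangle,$$ where $maj=Th_2^3$ is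 the ternary majority and $+$ is addition modulo $2$. The computational model is the random access machine with indirect addressing, addition, subtraction and multiplication. It works on natural numbers, subtraction being truncated at $0$, and it has random access to the input. A time bound $O(T)$ means that some program (depending only on the problem) solves every instance in at most $c\,(T+1)$ unit-cost steps, with all registers holding numbers of at most $c\log N$ bits, where $c$ is a constant and $N$ bounds the number of input registers and the numbers in them. $\mathsf P$ is the class of problems solvable by such a machine in polynomially many steps on numbers of polynomially many bits, with respect to the bit size of the input. Let $k\ge 2$ and let $\mathcal F$ be a Boolean clone with $Th_k^{k+1}\in\mathcal F$. Then $\textsc{Closure}_{\mathcal F}$ is solvable in time $O(mn^k)$. In particular, $\textsc{Closure}_{S_{10}^k}$ and $\textsc{Closure}_{S_{12}^k}$ (for every $k\ge2$) and $\textsc{Closure}_{D_1}$ are in $\mathsf P$. -/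

import Mathlib

namespace CloneClosure

/-! ### Operations, clones, closures -/

/-- A `t`-ary operation on `D`, with `t ≥ 1`. -/
structure Operation (D : Type) where
  arity : ℕ
  arity_pos : 0 < arity
  toFun : (Fin arity → D) → D

/-- The coordinatewise extension of an operation to vectors of size `n`. -/
def Operation.onVectors {D : Type} (f : Operation D) {n : ℕ}
    (w : Fin f.arity → (Fin n → D)) : Fin n → D :=
  fun i => f.toFun (fun j => w j i)

/-- The projection of arity `t` onto coordinate `i`. -/
def Operation.proj {D : Type} {t : ℕ} (i : Fin t) : Operation D :=
  ⟨t, i.pos, fun x => x i⟩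

/-- The composition `x ↦ f (g₁ x, …, gₛ x)` of an `s`-ary `f` with `t`-ary `g₁, …, gₛ`. -/
def Operation.comp {D : Type} (f : Operation D) {t : ℕ} (ht : 0 < t)
    (g : Fin f.arity → (Fin t → D) → D) : Operation D :=
  ⟨t, ht, fun x => f.toFun (fun j => g j x)⟩

/-- A (functional) clone: a set of operations that contains all projections and is closed under
composition. -/
structure IsClone {D : Type} (F : Set (Operation D)) : Prop where
  proj_mem : ∀ {t : ℕ} (i : Fin t), Operation.proj i ∈ F
  comp_mem : ∀ (f : Operation D) {t : ℕ} (ht : 0 < t) (g : Fin f.arity → (Fin t → D) → D),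
    f ∈ F → (∀ j, (⟨t, ht, g j⟩ : Operation D) ∈ F) → f.comp ht g ∈ F

/-- `IsGenerated F f`: the operation `f` is obtained by composition from operations in `F` and
projections. -/
inductive IsGenerated {D : Type} (F : Set (Operation D)) : Operation D → Prop
  | basic (f : Operation D) (hf : f ∈ F) : IsGenerated F f
  | proj {t : ℕ} (i : Fin t) : IsGenerated F (Operation.proj i)
  | comp (f : Operation D) {t : ℕ} (ht : 0 < t) (g : Fin f.arity → (Fin t → D) → D)
      (hf : IsGenerated F f) (hg : ∀ j, IsGenerated F ⟨t, ht, g j⟩) :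
      IsGenerated F (f.comp ht g)

/-- The clone `⟨F⟩` generated by `F`. -/
def generatedClone {D : Type} (F : Set (Operation D)) : Set (Operation D) :=
  {f | IsGenerated F f}

/-- Membership in the closure `Cl_F(S)`: the smallest set of vectors that contains `S` and is
closed under the coordinatewise action of the operations of `F`. -/
inductive InClosure {D : Type} (F : Set (Operation D)) {n : ℕ} (S : Set (Fin n → D)) :
    (Fin n → D) → Prop
  | basic (v : Fin n → D) (hv : v ∈ S) : InClosure F S v
  | app (f : Operation D) (hf : f ∈ F) (w : Fin f.arity → (Fin n → D))
      (hw : ∀ j, InClosure F S (w j)) : InClosure F S (f.onVectors w)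

/-! ### The Boolean operations and clones -/

/-- The threshold function `Th_k^{k+1}`: it has arity `k + 1` and is true if and only if at least
`k` of its arguments are. -/
def threshold (k : ℕ) : Operation Bool :=
  ⟨k + 1, k.succ_pos,
    fun x => decide (k ≤ (Finset.univ.filter (fun i : Fin (k + 1) => x i = true)).card)⟩

/-- The majority function of three arguments. -/
def maj : Operation Bool :=
  ⟨3, by norm_num, fun x => (x 0 && x 1) || (x 0 && x 2) || (x 1 && x 2)⟩

/-- `x ∧ (y ∨ z)` -/
def andOr : Operation Bool := ⟨3, by norm_num, fun x => x 0 && (x 1 || x 2)⟩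

/-- `x ∧ (y → z)` -/
def andImp : Operation Bool := ⟨3, by norm_num, fun x => x 0 && (!(x 1) || x 2)⟩

/-- `x + y + z` modulo two -/
def xor3 : Operation Bool := ⟨3, by norm_num, fun x => xor (xor (x 0) (x 1)) (x 2)⟩

/-- `S_10^k = ⟨Th_k^{k+1}, x ∧ (y ∨ z)⟩` -/
def S10 (k : ℕ) : Set (Operation Bool) := generatedClone {threshold k, andOr}

/-- `S_12^k = ⟨Th_k^{k+1}, x ∧ (y → z)⟩` -/
def S12 (k : ℕ) : Set (Operation Bool) := generatedClone {threshold k, andImp}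

/-- `D_1 = ⟨maj, x + y + z⟩` -/
def D1 : Set (Operation Bool) := generatedClone {maj, xor3}

/-! ### Random access machines -/

/-- Instructions of a random access machine. The machine has work registers `R[0], R[1], …`, each
holding a natural number, and read-only input registers `X[0], X[1], …`. -/
inductive Instr
  /-- `R[d] := c` -/
  | const (d c : ℕ)
  /-- `R[d] := R[a] + R[b]` -/
  | add (d a b : ℕ)
  /-- `R[d] := R[a] - R[b]`, or `0` if this is negative -/
  | sub (d a b : ℕ)
  /-- `R[d] := R[a] * R[b]` -/
  | mul (d a b : ℕ)
  /-- `R[d] := R[R[a]]` -/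
  | load (d a : ℕ)
  /-- `R[R[a]] := R[b]` -/
  | store (a b : ℕ)
  /-- `R[d] := X[R[a]]` -/
  | read (d a : ℕ)
  /-- jump to instruction `l` if `R[a] = 0` -/
  | jumpIfZero (a l : ℕ)

/-- A configuration: the index of the next instruction and the contents of the work registers. -/
structure Config where
  pc : ℕ
  reg : ℕ → ℕ

/-- The effect of one instruction, on input `x` (input registers beyond the end of `x` hold `0`). -/
def Instr.exec (x : List ℕ) (c : Config) : Instr → Config
  | .const d a => ⟨c.pc + 1, Function.update c.reg d a⟩
  | .add d a b => ⟨c.pc + 1, Function.update c.reg d (c.reg a + c.reg b)⟩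
  | .sub d a b => ⟨c.pc + 1, Function.update c.reg d (c.reg a - c.reg b)⟩
  | .mul d a b => ⟨c.pc + 1, Function.update c.reg d (c.reg a * c.reg b)⟩
  | .load d a => ⟨c.pc + 1, Function.update c.reg d (c.reg (c.reg a))⟩
  | .store a b => ⟨c.pc + 1, Function.update c.reg (c.reg a) (c.reg b)⟩
  | .read d a => ⟨c.pc + 1, Function.update c.reg d (x.getD (c.reg a) 0)⟩
  | .jumpIfZero a l => ⟨if c.reg a = 0 then l else c.pc + 1, c.reg⟩

/-- One step of the program `p`; a halted machine does not move. -/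
def step (p : List Instr) (x : List ℕ) (c : Config) : Config :=
  match p[c.pc]? with
  | some i => i.exec x c
  | none => c

/-- The configuration of the program `p` on input `x` after `s` steps. Initially all work registers
hold `0`. -/
def run (p : List Instr) (x : List ℕ) (s : ℕ) : Config :=
  (step p x)^[s] ⟨0, fun _ => 0⟩

/-- The machine has halted when there is no next instruction. -/
def Halted (p : List Instr) (c : Config) : Prop := p.length ≤ c.pc

/-- A decision problem: its instances, how an instance is presented in the input registers, and
the instances with answer yes. -/
structure DecisionProblem where
  Instance : Type
  input : Instance → List ℕ
  Yes : Set Instance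

/-- On the instance `I`, the program `p` halts after at most `t` steps with the correct answer in
`R[0]` (`1` for yes, `0` for no), and no register ever holds a number of more than `w` bits. -/
def DecidesWithin (P : DecisionProblem) (p : List Instr) (I : P.Instance) (t w : ℕ) : Prop :=
  ∃ s ≤ t, Halted p (run p (P.input I) s) ∧
    ((I ∈ P.Yes ∧ (run p (P.input I) s).reg 0 = 1) ∨
      (I ∉ P.Yes ∧ (run p (P.input I) s).reg 0 = 0)) ∧
    ∀ s' ≤ s, ∀ r, (run p (P.input I) s').reg r < 2 ^ w

/-- `P` is solvable in time `O(T)`: one program decides every instance `I` in at most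
`c * (T I + 1)` steps, where all numbers that occur have `O(log N)` bits, `N` bounding the number
of the input registers and the numbers they hold. (The `+ 1` only matters if `T I = 0`.) -/
def SolvableInTime (P : DecisionProblem) (T : P.Instance → ℕ) : Prop :=
  ∃ (p : List Instr) (c : ℕ), ∀ I : P.Instance,
    DecidesWithin P p I (c * (T I + 1))
      (c * Nat.size ((P.input I).length + (P.input I).sum + 1))

/-- The bit size of an input. -/
def bitSize (x : List ℕ) : ℕ := (x.map (fun a => Nat.size a + 1)).sum

/-- The class `P`: polynomially many steps, on numbers of polynomially many bits, in the bit size of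
the input (equivalently, polynomial time under the logarithmic cost criterion). -/
def InP (P : DecisionProblem) : Prop :=
  ∃ (p : List Instr) (q : Polynomial ℕ), ∀ I : P.Instance,
    DecidesWithin P p I (q.eval (bitSize (P.input I))) (q.eval (bitSize (P.input I)))

/-! ### The closure problem -/

/-- An instance of the closure problem: a vector `v` and a list `S` of `m` vectors, all of
size `n`. -/
structure ClosureInstance where
  n : ℕ
  m : ℕ
  v : Fin n → Bool
  S : Fin m → (Fin n → Bool)

/-- The instance as an input: `n`, `m`, the coordinates of `v`, and then the coordinates of the
vectors of `S`, one vector after the other. -/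
def ClosureInstance.input (I : ClosureInstance) : List ℕ :=
  [I.n, I.m] ++ (List.ofFn I.v).map Bool.toNat ++
    (List.ofFn (fun j => (List.ofFn (I.S j)).map Bool.toNat)).flatten

/-- `Closure_F`: does `v` belong to `Cl_F(S)`? -/
def closureProblem (F : Set (Operation Bool)) : DecisionProblem where
  Instance := ClosureInstance
  input := ClosureInstance.input
  Yes := {I | InClosure F (Set.range I.S) I.v}

end CloneClosure

namespace CloneClosure

/-! ### The Baker–Pixley theorem for threshold operations -/

/-! For `k ≥ 2` the threshold function is a near-unanimity operation of arity `k + 1`: one deviating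
argument never changes its value. By the Baker–Pixley argument (`exists_agree_of_forall_tuple`,
`inClosure_iff_forall_tuple`) a vector then lies in the closure as soon as each of its projections
to `k` coordinates lies in the closure of the projected generators. So `n ^ k` tests suffice.

One test costs `O(m)`: the projected generators form a subset of `{0,1}^k`, and there are only `2 ^
2 ^ k` of these. A finite automaton with the subsets as states reads the rows one by one, and a
final table lookup gives the answer. Both tables depend only on `F` and `k`, so their entries are
constants of the program; the closure table is chosen classically, and no algorithm for membership
in `F` is needed. `exec_tuple` verifies one test, `exec_nest` the loops over all tuples, and
`exec_closure` the whole program with the cases `m = 0` and `n = 0`.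

Membership in P follows by comparing `m * n ^ k` and the word length with the bit size of the input;
the three named clones contain a threshold function among their generators. -/

/-- Operations act coordinatewise, hence commute with any selection of coordinates, repetitions
included. -/
theorem InClosure.map {D : Type} {F : Set (Operation D)} {n k : ℕ} {S : Set (Fin n → D)}
    {v : Fin n → D} (e : Fin k → Fin n) (h : InClosure F S v) :
    InClosure F ((fun w => w ∘ e) '' S) (v ∘ e) := by
  induction h with
  | basic v hv => exact .basic _ ⟨v, hv, rfl⟩
  | app f hf w _ ih => exact InClosure.app f hf (fun j => w j ∘ e) ih

theorem InClosure.exists_lift {D : Type} {F : Set (Operation D)} {n k : ℕ} {S : Set (Fin n → D)}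
    {e : Fin k → Fin n} {u : Fin k → D} (h : InClosure F ((fun w => w ∘ e) '' S) u) :
    ∃ w, InClosure F S w ∧ w ∘ e = u := by
  induction h with
  | basic v hv =>
    obtain ⟨w, hw, rfl⟩ := hv
    exact ⟨w, .basic _ hw, rfl⟩
  | app f hf w _ ih =>
    choose g hg hgw using ih
    refine ⟨f.onVectors g, .app f hf g hg, ?_⟩
    funext i
    simp only [Function.comp, Operation.onVectors]
    congr 1
    funext j
    exact congrFun (hgw j) i

/-- If at most one argument deviates from `b`, the threshold function has value `b`. -/
theorem threshold_toFun_eq {k : ℕ} (hk : 2 ≤ k) (x : Fin (k + 1) → Bool) (b : Bool)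
    (i₀ : Fin (k + 1)) (h : ∀ i, i ≠ i₀ → x i = b) : (threshold k).toFun x = b := by
  have key : (threshold k).toFun x =
      decide (k ≤ (Finset.univ.filter (fun i : Fin (k + 1) => x i = true)).card) := rfl
  rw [key]
  cases b with
  | true =>
    have hsub : Finset.univ.erase i₀ ⊆ Finset.univ.filter (fun i : Fin (k + 1) => x i = true) := by
      intro i hi
      simp only [Finset.mem_erase, Finset.mem_univ, and_true] at hi
      simpa using h i hi
    have := Finset.card_le_card hsub
    rw [Finset.card_erase_of_mem (Finset.mem_univ _), Finset.card_univ, Fintype.card_fin] at this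
    simpa using this
  | false =>
    have hsub : Finset.univ.filter (fun i : Fin (k + 1) => x i = true) ⊆ {i₀} := by
      intro i hi
      simp only [Finset.mem_filter, Finset.mem_univ, true_and] at hi
      by_contra hne
      simp only [Finset.mem_singleton] at hne
      rw [h i hne] at hi
      exact Bool.false_ne_true hi
    have := Finset.card_le_card hsub
    rw [Finset.card_singleton] at this
    simp only [decide_eq_false_iff_not]
    omega

/-- Baker–Pixley induction on the size of `J`. Up to size `k`, a single tuple covers `J`. Beyond
that, omit in turn each of `k + 1` distinct elements of `J` and apply the threshold function to the
resulting `k + 1` vectors: at every coordinate of `J` at most one of them is wrong. -/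
theorem exists_agree_of_forall_tuple {k n : ℕ} (hk : 2 ≤ k) (hn : 0 < n)
    {F : Set (Operation Bool)} (hF : threshold k ∈ F) {S : Set (Fin n → Bool)} {v : Fin n → Bool}
    (h : ∀ e : Fin k → Fin n, InClosure F ((fun w => w ∘ e) '' S) (v ∘ e)) (c : ℕ) :
    ∀ J : Finset (Fin n), J.card = c → ∃ w, InClosure F S w ∧ ∀ j ∈ J, w j = v j := by
  induction c with
  | zero =>
    intro J hJ
    obtain ⟨w, hw, -⟩ := (h (fun _ => ⟨0, hn⟩)).exists_lift
    exact ⟨w, hw, by simp [Finset.card_eq_zero.mp hJ]⟩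
  | succ c ih =>
    intro J hJ
    by_cases hc : c + 1 ≤ k
    · let g := J.equivFin
      -- The tuple lists `J` and is padded with coordinate `0`; this is one use of `0 < n`.
      let e : Fin k → Fin n := fun i => if hi : i.1 < J.card then (g.symm ⟨i, hi⟩ : Fin n) else ⟨0, hn⟩
      obtain ⟨w, hw, hwe⟩ := (h e).exists_lift
      refine ⟨w, hw, fun j hj => ?_⟩
      have hlt := (g ⟨j, hj⟩).2
      have he : e ⟨(g ⟨j, hj⟩).1, by omega⟩ = j := by
        simp only [e]
        rw [dif_pos hlt]
        simp
      have := congrFun hwe ⟨(g ⟨j, hj⟩).1, by omega⟩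
      simpa only [Function.comp, he] using this
    · let g := J.equivFin
      let a : Fin (k + 1) → Fin n := fun i => (g.symm ⟨i, by omega⟩ : Fin n)
      have ha : Function.Injective a := by
        intro i i' hii
        have := g.symm.injective (Subtype.ext hii)
        simpa [Fin.ext_iff] using this
      have haJ : ∀ i, a i ∈ J := fun i => (g.symm ⟨i, by omega⟩).2
      have hex : ∀ i, ∃ w, InClosure F S w ∧ ∀ j ∈ J.erase (a i), w j = v j := fun i =>
        ih _ (by rw [Finset.card_erase_of_mem (haJ i)]; omega)
      choose w hw hwv using hex
      refine ⟨(threshold k).onVectors w, .app _ hF w hw, fun j hj => ?_⟩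
      by_cases hj' : ∃ i, a i = j
      · obtain ⟨i, rfl⟩ := hj'
        refine threshold_toFun_eq hk _ _ i fun i' hi' => hwv i' _ (Finset.mem_erase.mpr ⟨?_, hj⟩)
        exact fun heq => hi' (ha heq).symm
      · refine threshold_toFun_eq hk _ _ 0 fun i' _ => hwv i' _ (Finset.mem_erase.mpr ⟨?_, hj⟩)
        exact fun heq => hj' ⟨i', heq.symm⟩

/-- Membership in the closure is decided by the projections to `k` coordinates. -/
theorem inClosure_iff_forall_tuple {k n : ℕ} (hk : 2 ≤ k) (hn : 0 < n) {F : Set (Operation Bool)}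
    (hF : threshold k ∈ F) (S : Set (Fin n → Bool)) (v : Fin n → Bool) :
    InClosure F S v ↔ ∀ e : Fin k → Fin n, InClosure F ((fun w => w ∘ e) '' S) (v ∘ e) := by
  refine ⟨fun h e => h.map e, fun h => ?_⟩
  obtain ⟨w, hw, hwv⟩ := exists_agree_of_forall_tuple hk hn hF h _ Finset.univ rfl
  rwa [show v = w from funext fun j => (hwv j (Finset.mem_univ j)).symm]

/-- There are no nullary operations, so nothing arises from no generators. This settles `m = 0`. -/
theorem not_inClosure_empty {D : Type} {F : Set (Operation D)} {n : ℕ} {v : Fin n → D} :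
    ¬ InClosure F ∅ v := by
  intro h
  induction h with
  | basic v hv => exact hv
  | app f _ _ _ ih => exact ih ⟨0, f.arity_pos⟩

/-! ### Verified program fragments -/

/-- A program fragment, as a function of the position at which it is placed. -/
abbrev Code := ℕ → List Instr

/-- In at most `t` steps the machine moves from `c` to `c'`, all registers staying below `W`. -/
def Reach (p : List Instr) (x : List ℕ) (W t : ℕ) (c c' : Config) : Prop :=
  ∃ u ≤ t, (step p x)^[u] c = c' ∧ ∀ u' ≤ u, ∀ r, ((step p x)^[u'] c).reg r < W

theorem Reach.refl {p : List Instr} {x : List ℕ} {W : ℕ} {c : Config} (h : ∀ r, c.reg r < W) :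
    Reach p x W 0 c c :=
  ⟨0, le_rfl, rfl, fun u' hu' => by rw [Nat.le_zero.mp hu']; exact h⟩

theorem Reach.bounded {p : List Instr} {x : List ℕ} {W t : ℕ} {c c' : Config}
    (h : Reach p x W t c c') : ∀ r, c'.reg r < W := by
  obtain ⟨u, -, rfl, hu⟩ := h
  exact hu u le_rfl

theorem Reach.mono {p : List Instr} {x : List ℕ} {W t t' : ℕ} {c c' : Config}
    (h : Reach p x W t c c') (ht : t ≤ t') : Reach p x W t' c c' := by
  obtain ⟨u, hu, h⟩ := h
  exact ⟨u, hu.trans ht, h⟩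

theorem Reach.trans {p : List Instr} {x : List ℕ} {W t t' : ℕ} {c c' c'' : Config}
    (h : Reach p x W t c c') (h' : Reach p x W t' c' c'') : Reach p x W (t + t') c c'' := by
  obtain ⟨u, hu, rfl, hb⟩ := h
  obtain ⟨u', hu', rfl, hb'⟩ := h'
  refine ⟨u' + u, by omega, Function.iterate_add_apply _ _ _ _, fun i hi r => ?_⟩
  by_cases hiu : i ≤ u
  · exact hb i hiu r
  · have := hb' (i - u) (by omega) r
    rwa [← Function.iterate_add_apply, Nat.sub_add_cancel (by omega)] at this

theorem Reach.single {p : List Instr} {x : List ℕ} {W : ℕ} {c c' : Config} {i : Instr}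
    (hi : p[c.pc]? = some i) (hc' : i.exec x c = c') (h : ∀ r, c.reg r < W)
    (h' : ∀ r, c'.reg r < W) : Reach p x W 1 c c' := by
  have hs : step p x c = c' := by simp [step, hi, hc']
  refine ⟨1, le_rfl, hs, fun u' hu' => ?_⟩
  interval_cases u'
  · exact h
  · simpa [hs] using h'

/-- The list `L` occurs in `p` at position `o`. -/
def Located (p : List Instr) (o : ℕ) (L : List Instr) : Prop :=
  ∀ i < L.length, p[o + i]? = L[i]?

theorem Located.left {p : List Instr} {o : ℕ} {L L' : List Instr} (h : Located p o (L ++ L')) :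
    Located p o L := by
  intro i hi
  rw [h i (by simp; omega), List.getElem?_append_left hi]

theorem Located.right {p : List Instr} {o : ℕ} {L L' : List Instr} (h : Located p o (L ++ L')) :
    Located p (o + L.length) L' := by
  intro i hi
  rw [Nat.add_assoc, h _ (by simp; omega), List.getElem?_append_right (by omega)]
  congr 1
  omega

theorem Located.head {p : List Instr} {o : ℕ} {i : Instr} {L : List Instr}
    (h : Located p o (i :: L)) : p[o]? = some i := by
  simpa using h 0 (by simp)

/-- Started with registers `s`, all below `W`, the fragment `b` terminates normally within `t`
steps, the registers then satisfy `Q`, and they stay below `W`. -/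
def Exec (x : List ℕ) (W : ℕ) (b : Code) (t : ℕ) (s : ℕ → ℕ) (Q : (ℕ → ℕ) → Prop) : Prop :=
  (∀ r, s r < W) → ∀ p o, Located p o (b o) →
    ∃ s', Q s' ∧ Reach p x W t ⟨o, s⟩ ⟨o + (b o).length, s'⟩

namespace Code

/-- Sequential composition. -/
def seq (b b' : Code) : Code := fun o => b o ++ b' (o + (b o).length)

/-- A single instruction. -/
def single (i : Instr) : Code := fun _ => [i]

/-- Repeat `b` until the register `f` is nonzero. -/
def untilNonzero (f : ℕ) (b : Code) : Code := fun o => b o ++ [.jumpIfZero f o]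

/-- Skip `b` if the register `a` is zero. -/
def unlessZero (a : ℕ) (b : Code) : Code :=
  fun o => [.jumpIfZero a (o + 1 + (b (o + 1)).length)] ++ b (o + 1)

end Code

infixr:60 " ;; " => Code.seq

section Rules

variable {x : List ℕ} {W : ℕ} {s : ℕ → ℕ} {Q R : (ℕ → ℕ) → Prop} {b b' : Code} {t t' : ℕ}

theorem Exec.mono (h : Exec x W b t s Q) (ht : t ≤ t') (hQ : ∀ s', Q s' → R s') :
    Exec x W b t' s R := by
  intro hs p o hl
  obtain ⟨s', h1, h2⟩ := h hs p o hl
  exact ⟨s', hQ _ h1, h2.mono ht⟩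

theorem Exec.seq (h : Exec x W b t s Q) (h' : ∀ s', Q s' → Exec x W b' t' s' R) :
    Exec x W (b ;; b') (t + t') s R := by
  intro hs p o hl
  obtain ⟨s', hQ, hr⟩ := h hs p o hl.left
  obtain ⟨s'', hR, hr'⟩ := h' s' hQ hr.bounded p _ hl.right
  refine ⟨s'', hR, ?_⟩
  simpa [Code.seq, Nat.add_assoc] using hr.trans hr'

/-- Common form of the rules for instructions that write one register. The bound on the new value
may use the bound on the old registers, so subtraction and `load` need no side condition. -/
theorem Exec.of_update {i : Instr} {d a : ℕ}
    (hi : ∀ pc, i.exec x ⟨pc, s⟩ = ⟨pc + 1, Function.update s d a⟩)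
    (ha : (∀ r, s r < W) → a < W) (hQ : Q (Function.update s d a)) :
    Exec x W (.single i) 1 s Q := by
  intro hs p o hl
  refine ⟨_, hQ, Reach.single (Located.head hl) (hi o) hs fun r => ?_⟩
  by_cases hr : r = d
  · subst hr
    simpa using ha hs
  · simpa [Function.update_of_ne hr] using hs r

theorem Exec.const {d a : ℕ} (ha : a < W) (hQ : Q (Function.update s d a)) :
    Exec x W (.single (.const d a)) 1 s Q :=
  .of_update (fun _ => rfl) (fun _ => ha) hQ

theorem Exec.add {d a a' : ℕ} (ha : s a + s a' < W) (hQ : Q (Function.update s d (s a + s a'))) :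
    Exec x W (.single (.add d a a')) 1 s Q :=
  .of_update (fun _ => rfl) (fun _ => ha) hQ

theorem Exec.sub {d a a' : ℕ} (hQ : Q (Function.update s d (s a - s a'))) :
    Exec x W (.single (.sub d a a')) 1 s Q :=
  .of_update (fun _ => rfl) (fun h => (Nat.sub_le _ _).trans_lt (h a)) hQ

theorem Exec.mul {d a a' : ℕ} (ha : s a * s a' < W) (hQ : Q (Function.update s d (s a * s a'))) :
    Exec x W (.single (.mul d a a')) 1 s Q :=
  .of_update (fun _ => rfl) (fun _ => ha) hQ

theorem Exec.load {d a : ℕ} (hQ : Q (Function.update s d (s (s a)))) :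
    Exec x W (.single (.load d a)) 1 s Q :=
  .of_update (fun _ => rfl) (fun h => h _) hQ

theorem Exec.read {d a : ℕ} (ha : x.getD (s a) 0 < W)
    (hQ : Q (Function.update s d (x.getD (s a) 0))) :
    Exec x W (.single (.read d a)) 1 s Q :=
  .of_update (fun _ => rfl) (fun _ => ha) hQ

theorem Exec.nil (hQ : Q s) : Exec x W (fun _ => []) 0 s Q :=
  fun hs _ _ _ => ⟨s, hQ, Reach.refl hs⟩

theorem Exec.unlessZero {a : ℕ} (h0 : s a = 0 → Q s) (h1 : s a ≠ 0 → Exec x W b t s Q) :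
    Exec x W (.unlessZero a b) (t + 1) s Q := by
  intro hs p o hl
  by_cases ha : s a = 0
  · refine ⟨s, h0 ha, (Reach.single (Located.head hl) ?_ hs hs).mono (by omega)⟩
    simp [Instr.exec, ha, Code.unlessZero]
    omega
  · obtain ⟨s', hQ, hr⟩ := h1 ha hs p (o + 1) (Located.right (L := [_]) hl)
    refine ⟨s', hQ, ?_⟩
    have h := (Reach.single (c := ⟨o, s⟩) (c' := ⟨o + 1, s⟩) (Located.head hl)
      (by simp [Instr.exec, ha]) hs hs).trans hr
    have e : o + (Code.unlessZero a b o).length = o + 1 + (b (o + 1)).length := by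
      simp [Code.unlessZero]
      omega
    rw [e]
    exact h.mono (by omega)

/-- A loop whose invariant is indexed by the number of the remaining rounds. -/
theorem Exec.untilNonzero {f : ℕ} (Inv : ℕ → (ℕ → ℕ) → Prop) (N : ℕ)
    (hb : ∀ j < N, ∀ s, Inv (j + 1) s →
      Exec x W b t s (fun s' => Inv j s' ∧ (s' f = 0 ↔ j ≠ 0)))
    (hN : 0 < N) (hs : Inv N s) : Exec x W (.untilNonzero f b) (N * (t + 1)) s (Inv 0) := by
  induction N generalizing s with
  | zero => omega
  | succ N ih =>
    intro hs0 p o hl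
    obtain ⟨s', ⟨hI, hf⟩, hr⟩ := hb N (by omega) s hs hs0 p o hl.left
    have hj := Located.head hl.right
    -- `N` now counts the rounds after the current one: at `0` the jump falls through, otherwise it
    -- returns to `o`.
    by_cases h0 : N = 0
    · subst h0
      refine ⟨s', hI, ?_⟩
      rw [Nat.zero_add, Nat.one_mul]
      refine hr.trans (Reach.single hj ?_ hr.bounded hr.bounded)
      have : s' f ≠ 0 := by simpa using hf
      simp [Instr.exec, this, Code.untilNonzero, Nat.add_assoc]
    · obtain ⟨s'', hI', hr'⟩ := ih (fun j hj => hb j (by omega)) (by omega) hI hr.bounded p o hl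
      refine ⟨s'', hI', ((hr.trans (Reach.single (c' := ⟨o, s'⟩) hj ?_
        hr.bounded hr.bounded)).trans hr').mono (le_of_eq (by ring))⟩
      simp [Instr.exec, hf.mpr h0]

end Rules

/-! ### The program -/

/-- The number with the binary digits `w 0, …, w (l - 1)`. -/
def bitCode (w : ℕ → Bool) : ℕ → ℕ
  | 0 => 0
  | l + 1 => 2 * bitCode w l + (w l).toNat

theorem bitCode_lt (w : ℕ → Bool) (l : ℕ) : bitCode w l < 2 ^ l := by
  induction l with
  | zero => simp [bitCode]
  | succ l ih =>
    have := Bool.toNat_le (w l)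
    simp only [bitCode, pow_succ]
    omega

theorem bitCode_injective {w w' : ℕ → Bool} {l : ℕ} (h : bitCode w l = bitCode w' l) :
    ∀ i < l, w i = w' i := by
  induction l with
  | zero => intro i hi; omega
  | succ l ih =>
    simp only [bitCode] at h
    have h1 := Bool.toNat_le (w l)
    have h2 := Bool.toNat_le (w' l)
    intro i hi
    rcases Nat.lt_succ_iff_lt_or_eq.mp hi with hi | rfl
    · exact ih (by omega) i hi
    · have h3 : (w i).toNat = (w' i).toNat := by omega
      revert h3
      cases w i <;> cases w' i <;> simp

/-- Sets of vectors of size `k` are represented by numbers; this table inserts the vector with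
number `t % 2 ^ k` into the set with number `t / 2 ^ k`. -/
def insertTable (k t : ℕ) : ℕ := (t / 2 ^ k) ||| 2 ^ (t % 2 ^ k)

/-- The set of vectors that is represented by a number. -/
def vectorSet (k a : ℕ) : Set (Fin k → Bool) :=
  {w | ∃ u : ℕ → Bool, a.testBit (bitCode u k) = true ∧ w = fun l : Fin k => u l}

open Classical in
/-- The truth table of: the vector with number `t % 2 ^ k` belongs to the closure of the set with
number `t / 2 ^ k`. -/
noncomputable def closureTable (F : Set (Operation Bool)) (k t : ℕ) : ℕ :=
  if ∃ u : ℕ → Bool, bitCode u k = t % 2 ^ k ∧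
    InClosure F (vectorSet k (t / 2 ^ k)) (fun l => u l) then 1 else 0

/-- The size of either table. -/
def tableSize (k : ℕ) : ℕ := 2 ^ 2 ^ k * 2 ^ k

namespace Code

/-- Write the first `M` values of `f` to the registers from `a` on. -/
def table (a : ℕ) (f : ℕ → ℕ) : ℕ → Code
  | 0 => fun _ => []
  | M + 1 => table a f M ;; single (.const (a + M) (f M))

/-- Append the entries of the current row in the first `l` of the current columns to the binary
number in register 6. -/
def digits : ℕ → Code
  | 0 => fun _ => []
  | l + 1 => digits l ;; single (.add 7 4 (10 + l)) ;; single (.read 7 7) ;;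
      single (.add 6 6 6) ;; single (.add 6 6 7)

/-- Replace the state in register 6 by the value that the table at the address in register `a`
has for this state and the current row. -/
def lookup (k a : ℕ) : Code := digits k ;; single (.add 7 6 a) ;; single (.load 6 7)

/-- Treat the current tuple of columns. -/
def tuple (k : ℕ) : Code :=
  -- Registers: 0 answer, 1 `n`, 2 `m`, 3 the constant one, 4 offset `1 + j * n` of row `j`, 5 row
  -- counter `j`, 6 state, 7 scratch and loop flag, 8 and 9 table addresses, from 10 on the `k`
  -- columns, then the tables. Rows are read from `m` down to `1`, which leaves register 4 at row
  -- `0`, the vector `v`. The flag `1 - j` is nonzero exactly at `j = 0`.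
  single (.const 6 0) ;; single (.mul 4 1 2) ;; single (.add 4 4 3) ;; single (.add 5 2 6) ;;
  untilNonzero 7 (lookup k 8 ;; single (.sub 4 4 1) ;; single (.sub 5 5 3) ;;
    single (.sub 7 3 5)) ;;
  lookup k 9 ;; single (.mul 0 0 6)

/-- Treat all tuples of columns, where only the first `l` columns vary. -/
def nest (k : ℕ) : ℕ → Code
  | 0 => tuple k
  | l + 1 => single (.const 7 0) ;; single (.add (10 + l) 1 7) ;;
      untilNonzero 7 (nest k l ;; single (.sub (10 + l) (10 + l) 3) ;; single (.sub 7 3 (10 + l)))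

/-- The program that decides the closure problem of `F`. -/
noncomputable def closure (F : Set (Operation Bool)) (k : ℕ) : Code :=
  single (.const 7 0) ;; single (.read 1 7) ;; single (.const 3 1) ;; single (.read 2 3) ;;
  unlessZero 2 (single (.const 0 1) ;;
    unlessZero 1 (single (.const 8 (10 + k)) ;; single (.const 9 (10 + k + tableSize k)) ;;
      table (10 + k) (insertTable k) (tableSize k) ;;
      table (10 + k + tableSize k) (closureTable F k) (tableSize k) ;; nest k k))

end Code

/-! ### Correctness of the program -/

theorem exec_table {x : List ℕ} {W : ℕ} (a : ℕ) (f : ℕ → ℕ) (M : ℕ) (hf : ∀ e < M, f e < W)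
    (s : ℕ → ℕ) : Exec x W (.table a f M) M s (fun s' =>
      (∀ e < M, s' (a + e) = f e) ∧ ∀ r, (r < a ∨ a + M ≤ r) → s' r = s r) := by
  induction M with
  | zero => exact .nil ⟨fun e he => by omega, fun _ _ => rfl⟩
  | succ M ih =>
    refine (ih fun e he => hf e (by omega)).seq fun s' ⟨h1, h2⟩ =>
      .const (hf M (by omega)) ⟨fun e he => ?_, fun r hr => ?_⟩
    · rcases Nat.lt_succ_iff_lt_or_eq.mp he with he | rfl
      · rw [Function.update_of_ne (by omega), h1 e he]
      · simp
    · rw [Function.update_of_ne (by omega), h2 r (by omega)]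

/-- The entries `b j i` with `j ≤ m` and `1 ≤ i ≤ n` of a matrix are found in the input. -/
def Presents (x : List ℕ) (n m : ℕ) (b : ℕ → ℕ → Bool) : Prop :=
  ∀ j ≤ m, ∀ i, 1 ≤ i → i ≤ n → x.getD (1 + j * n + i) 0 = (b j i).toNat

/-- What the registers hold throughout the main part of the program. -/
structure Ready (F : Set (Operation Bool)) (k n m : ℕ) (s : ℕ → ℕ) : Prop where
  n_eq : s 1 = n
  m_eq : s 2 = m
  one_eq : s 3 = 1
  insert_eq : s 8 = 10 + k
  closure_eq : s 9 = 10 + k + tableSize k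
  insert_table : ∀ e < tableSize k, s (10 + k + e) = insertTable k e
  closure_table : ∀ e < tableSize k, s (10 + k + tableSize k + e) = closureTable F k e

theorem Ready.congr {F : Set (Operation Bool)} {k n m : ℕ} {s s' : ℕ → ℕ}
    (h : Ready F k n m s)
    (h' : ∀ r, (1 ≤ r ∧ r ≤ 3) ∨ 8 ≤ r ∧ r ≤ 9 ∨ 10 + k ≤ r → s' r = s r) :
    Ready F k n m s' where
  n_eq := (h' _ (by omega)).trans h.n_eq
  m_eq := (h' _ (by omega)).trans h.m_eq
  one_eq := (h' _ (by omega)).trans h.one_eq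
  insert_eq := (h' _ (by omega)).trans h.insert_eq
  closure_eq := (h' _ (by omega)).trans h.closure_eq
  insert_table e he := (h' _ (by omega)).trans (h.insert_table e he)
  closure_table e he := (h' _ (by omega)).trans (h.closure_table e he)

section Correctness

variable {F : Set (Operation Bool)} {k n m W : ℕ} {x : List ℕ} {b : ℕ → ℕ → Bool}

theorem table_index_lt {a p k : ℕ} (ha : a < 2 ^ 2 ^ k) (hp : p < 2 ^ k) :
    a * 2 ^ k + p < tableSize k := by
  have : (a + 1) * 2 ^ k ≤ 2 ^ 2 ^ k * 2 ^ k := Nat.mul_le_mul_right _ ha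
  rw [tableSize]
  linarith

theorem exec_digits (hx : Presents x n m b) (hW : 1 + m * n + n < W) (hk : tableSize k ≤ W)
    {j a : ℕ} (hj : j ≤ m) (ha : a < 2 ^ 2 ^ k) (e : ℕ → ℕ) (he : ∀ l < k, 1 ≤ e l ∧ e l ≤ n)
    (s : ℕ → ℕ) (h4 : s 4 = 1 + j * n) (h6 : s 6 = a) (hs : ∀ l < k, s (10 + l) = e l) (l : ℕ)
    (hl : l ≤ k) : Exec x W (.digits l) (4 * l) s (fun s' =>
      s' 6 = a * 2 ^ l + bitCode (fun i => b j (e i)) l ∧ ∀ r, r ≠ 6 → r ≠ 7 → s' r = s r) := by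
  induction l with
  | zero => exact .nil ⟨by simp [bitCode, h6], fun _ _ _ => rfl⟩
  | succ l ih =>
    have hjm : j * n ≤ m * n := Nat.mul_le_mul_right _ hj
    obtain ⟨he1, he2⟩ := he l (by omega)
    have hbit := Bool.toNat_le (b j (e l))
    -- As `l + 1 ≤ k`, even the intermediate numbers stay below `tableSize k`.
    have hlt : 2 * (a * 2 ^ l + bitCode (fun i => b j (e i)) l) + (b j (e l)).toNat < W := by
      have h1 := bitCode_lt (fun i => b j (e i)) (l + 1)
      have h2 : 2 ^ (l + 1) ≤ 2 ^ k := Nat.pow_le_pow_right (by omega) hl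
      have h3 : (a + 1) * 2 ^ (l + 1) ≤ 2 ^ 2 ^ k * 2 ^ k := Nat.mul_le_mul ha h2
      rw [tableSize] at hk
      simp only [bitCode] at h1
      have : a * 2 ^ (l + 1) = 2 * (a * 2 ^ l) := by ring
      linarith
    refine (((ih (by omega)).seq fun s' ⟨hs6, hs'⟩ => ?_)).mono (t := 4 * l + 4) (by omega)
      (fun _ h => h)
    have e4 : s' 4 = 1 + j * n := (hs' _ (by omega) (by omega)).trans h4
    have el : s' (10 + l) = e l := (hs' _ (by omega) (by omega)).trans (hs l (by omega))
    have hrd := hx j hj (e l) he1 he2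
    refine Exec.seq (t := 1) (t' := 3) (Exec.add (Q := fun s'' =>
      s'' = Function.update s' 7 (1 + j * n + e l)) (by omega) (by rw [e4, el])) ?_
    rintro _ rfl
    refine Exec.seq (t := 1) (t' := 2) (Exec.read (Q := fun s'' =>
      s'' = Function.update s' 7 (b j (e l)).toNat) (by
        rw [Function.update_self, hrd]; omega) (by
        rw [Function.update_self, hrd, Function.update_idem])) ?_
    rintro _ rfl
    refine Exec.seq (t := 1) (t' := 1) (Exec.add (by simp [hs6]; omega) rfl) ?_
    rintro _ rfl
    refine Exec.add ?_ ⟨?_, fun r hr6 hr7 => ?_⟩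
    · simp [hs6]
      omega
    · simp [hs6, bitCode]
      ring
    · simp [hr6, hr7, hs' r hr6 hr7]

/-- Appending the `k` digits of the row to the state `a` gives the table index `a * 2 ^ k + p`.
Address register 8 yields a state transition, 9 the final answer. -/
theorem exec_lookup (hx : Presents x n m b) (hW : 1 + m * n + n < W)
    (hk : 10 + k + 2 * tableSize k ≤ W) {j a c f : ℕ} (hj : j ≤ m) (ha : a < 2 ^ 2 ^ k)
    (e : ℕ → ℕ) (he : ∀ l < k, 1 ≤ e l ∧ e l ≤ n) (s : ℕ → ℕ) (h4 : s 4 = 1 + j * n)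
    (h6 : s 6 = a) (hs : ∀ l < k, s (10 + l) = e l) (hc : c ≠ 6) (hc' : c ≠ 7) (hf : s c = f)
    (hf1 : 10 + k ≤ f) (hf2 : f ≤ 10 + k + tableSize k) :
    Exec x W (.lookup k c) (4 * k + 2) s (fun s' =>
      s' 6 = s (f + (a * 2 ^ k + bitCode (fun i => b j (e i)) k)) ∧
        ∀ r, r ≠ 6 → r ≠ 7 → s' r = s r) := by
  have hlt := table_index_lt ha (bitCode_lt (fun i => b j (e i)) k)
  refine (exec_digits hx hW (by omega) hj ha e he s h4 h6 hs k le_rfl).seq fun s' ⟨h6', hs'⟩ => ?_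
  have ec : s' c = f := (hs' _ hc hc').trans hf
  refine Exec.seq (t := 1) (t' := 1) (Exec.add (by omega) rfl) ?_
  rintro _ rfl
  refine Exec.load ⟨?_, fun r hr6 hr7 => ?_⟩
  · simp only [Function.update_self]
    rw [Function.update_of_ne (by omega), hs' _ (by omega) (by omega), h6', ec, Nat.add_comm]
  · simp [hr6, hr7, hs' r hr6 hr7]

theorem insertTable_index {k a p : ℕ} (hp : p < 2 ^ k) :
    insertTable k (a * 2 ^ k + p) = a ||| 2 ^ p := by
  rw [insertTable, Nat.mul_comm, Nat.mul_add_div (by positivity), Nat.div_eq_of_lt hp,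
    Nat.mul_add_mod, Nat.mod_eq_of_lt hp, Nat.add_zero]

open Classical in
-- The existential in the table is harmless, since `bitCode` determines the first `k` digits and the
-- vector sees no others.
theorem closureTable_index (F : Set (Operation Bool)) {k a : ℕ} (u : ℕ → Bool) :
    closureTable F k (a * 2 ^ k + bitCode u k) =
      if InClosure F (vectorSet k a) (fun l => u l) then 1 else 0 := by
  have hp := bitCode_lt u k
  rw [closureTable, Nat.mul_comm, Nat.mul_add_div (by positivity), Nat.div_eq_of_lt hp,
    Nat.mul_add_mod, Nat.mod_eq_of_lt hp, Nat.add_zero]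
  congr 1
  refine propext ⟨?_, fun h => ⟨u, rfl, h⟩⟩
  rintro ⟨u', hu, h⟩
  convert h using 2 with l
  exact (bitCode_injective hu l l.2).symm

/-- The projection of row `0` of the matrix `b` to the columns `e` lies in the closure of the
projections of the other rows. -/
def TupleTest (F : Set (Operation Bool)) (k m : ℕ) (b : ℕ → ℕ → Bool) (e : ℕ → ℕ) : Prop :=
  InClosure F {w | ∃ j, 1 ≤ j ∧ j ≤ m ∧ w = fun l : Fin k => b j (e l)} (fun l => b 0 (e l))

open Classical in
theorem exec_tuple (hx : Presents x n m b) (hW : 1 + m * n + n < W) (hmW : m < W)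
    (hk : 10 + k + 2 * tableSize k ≤ W) (hm : 0 < m)
    (e : ℕ → ℕ) (he : ∀ l < k, 1 ≤ e l ∧ e l ≤ n) (s : ℕ → ℕ) (hR : Ready F k n m s)
    (hs : ∀ l < k, s (10 + l) = e l) (h0 : s 0 ≤ 1) :
    Exec x W (.tuple k) (m * (4 * k + 6) + (4 * k + 7)) s (fun s' => Ready F k n m s' ∧
      (∀ l < k, s' (10 + l) = e l) ∧ s' 0 ≤ 1 ∧
      (s' 0 = 1 ↔ s 0 = 1 ∧ TupleTest F k m b e)) := by
  -- With `j` rows left, the bits of register 6 mark the projections of the rows `j + 1, …, m`.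
  let Inv : ℕ → (ℕ → ℕ) → Prop := fun j s' =>
    (∀ r, (r < 4 ∨ 8 ≤ r) → s' r = s r) ∧ s' 4 = 1 + j * n ∧ s' 5 = j ∧ s' 6 < 2 ^ 2 ^ k ∧
      ∀ p, (s' 6).testBit p = true ↔
        ∃ j', j < j' ∧ j' ≤ m ∧ bitCode (fun i => b j' (e i)) k = p
  have hready : ∀ s' : ℕ → ℕ, (∀ r, (r < 4 ∨ 8 ≤ r) → s' r = s r) → Ready F k n m s' :=
    fun s' h => hR.congr fun r hr => h r (by omega)
  have hmn : n * m = m * n := Nat.mul_comm n m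
  have hbody : ∀ j < m, ∀ s', Inv (j + 1) s' →
      Exec x W (.lookup k 8 ;; .single (.sub 4 4 1) ;; .single (.sub 5 5 3) ;;
        .single (.sub 7 3 5)) (4 * k + 2 + 3) s' (fun s'' => Inv j s'' ∧ (s'' 7 = 0 ↔ j ≠ 0)) := by
    rintro j hj s' ⟨hfr, h4, h5, h6, hbits⟩
    have hR' := hready s' hfr
    have hp := bitCode_lt (fun i => b (j + 1) (e i)) k
    refine (exec_lookup hx hW hk (show j + 1 ≤ m by omega) h6 e he s' h4 rfl
      (fun l hl => (hfr _ (by omega)).trans (hs l hl)) (by omega) (by omega)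
      hR'.insert_eq le_rfl (by omega)).seq ?_
    rintro s₁ ⟨h6₁, hfr₁⟩
    rw [hR'.insert_table _ (table_index_lt h6 hp), insertTable_index hp] at h6₁
    refine Exec.seq (t := 1) (t' := 2) (Exec.sub rfl) ?_
    rintro _ rfl
    refine Exec.seq (t := 1) (t' := 1) (Exec.sub rfl) ?_
    rintro _ rfl
    have e1 : s₁ 1 = n := (hfr₁ _ (by omega) (by omega)).trans hR'.n_eq
    have e3 : s₁ 3 = 1 := (hfr₁ _ (by omega) (by omega)).trans hR'.one_eq
    have e4 : s₁ 4 = 1 + (j + 1) * n := (hfr₁ _ (by omega) (by omega)).trans h4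
    have e5 : s₁ 5 = j + 1 := (hfr₁ _ (by omega) (by omega)).trans h5
    refine Exec.sub ⟨⟨fun r hr => ?_, ?_, ?_, ?_, fun p => ?_⟩, ?_⟩
    · rw [Function.update_of_ne (by omega), Function.update_of_ne (by omega),
        Function.update_of_ne (by omega), hfr₁ r (by omega) (by omega), hfr r hr]
    · simp [e1, e4, Nat.add_mul]
      omega
    · simp [e3, e5]
    · simp only [ne_eq, Nat.reduceEqDiff, not_false_eq_true,
        Function.update_of_ne, h6₁]
      exact Nat.or_lt_two_pow h6 (Nat.pow_lt_pow_right (by omega) hp)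
    · simp only [ne_eq, Nat.reduceEqDiff, not_false_eq_true,
        Function.update_of_ne, h6₁, Nat.testBit_or, Bool.or_eq_true, hbits, Nat.testBit_two_pow,
        decide_eq_true_eq]
      constructor
      · rintro (⟨j', h1, h2, h3⟩ | h)
        · exact ⟨j', by omega, h2, h3⟩
        · exact ⟨j + 1, by omega, by omega, h⟩
      · rintro ⟨j', h1, h2, h3⟩
        by_cases hjj : j' = j + 1
        · subst hjj
          exact .inr h3
        · exact .inl ⟨j', by omega, h2, h3⟩
    · simp [e3, e5]
      omega
  refine Exec.mono (t := 1 + (1 + (1 + (1 + (m * (4 * k + 2 + 3 + 1) + (4 * k + 2 + 1))))))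
    ?_ (by ring_nf; omega) (fun _ h => h)
  refine Exec.seq (Exec.const (by omega) rfl) ?_
  rintro _ rfl
  refine Exec.seq (Exec.mul (by simp [hR.n_eq, hR.m_eq]; omega) rfl) ?_
  rintro _ rfl
  refine Exec.seq (Exec.add (by simp [hR.n_eq, hR.m_eq, hR.one_eq]; omega) rfl) ?_
  rintro _ rfl
  refine Exec.seq (Exec.add (by simp [hR.m_eq]; omega) rfl) ?_
  rintro _ rfl
  refine Exec.seq (Exec.untilNonzero Inv m hbody hm ⟨fun r hr => ?_, ?_, ?_, ?_, fun p => ?_⟩) ?_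
  · rw [Function.update_of_ne (by omega), Function.update_of_ne (by omega),
      Function.update_of_ne (by omega), Function.update_of_ne (by omega)]
  · simp [hR.n_eq, hR.m_eq, hR.one_eq]
    omega
  · simp [hR.m_eq]
  · simp
  · simp
    intro j' h1 h2
    omega
  rintro s' ⟨hfr, h4, -, h6, hbits⟩
  have hR' := hready s' hfr
  refine (exec_lookup hx hW hk (Nat.zero_le m) h6 e he s' h4 rfl
    (fun l hl => (hfr _ (by omega)).trans (hs l hl)) (by omega) (by omega)
    hR'.closure_eq (by omega) le_rfl).seq ?_
  rintro s₁ ⟨h6₁, hfr₁⟩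
  rw [hR'.closure_table _ (table_index_lt h6 (bitCode_lt _ k)), closureTable_index] at h6₁
  have hset : vectorSet k (s' 6) = {w | ∃ j, 1 ≤ j ∧ j ≤ m ∧ w = fun l : Fin k => b j (e l)} := by
    ext w
    simp only [vectorSet, Set.mem_ofPred_eq, hbits]
    constructor
    · rintro ⟨u, ⟨j, h1, h2, h3⟩, rfl⟩
      exact ⟨j, h1, h2, funext fun l => (bitCode_injective h3 l l.2).symm⟩
    · rintro ⟨j, h1, h2, rfl⟩
      exact ⟨fun i => b j (e i), ⟨j, h1, h2, rfl⟩, rfl⟩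
  rw [hset] at h6₁
  have h00 : s₁ 0 = s 0 := (hfr₁ _ (by omega) (by omega)).trans (hfr _ (by omega))
  have h61 : s₁ 6 = if TupleTest F k m b e then 1 else 0 := h6₁
  have hle : s₁ 0 * s₁ 6 ≤ 1 := by
    rw [h00, h61]
    split <;> omega
  refine Exec.mul (by omega) ⟨hR'.congr fun r hr => ?_, fun l hl => ?_, by simpa using hle, ?_⟩
  · rw [Function.update_of_ne (by omega), hfr₁ r (by omega) (by omega)]
  · rw [Function.update_of_ne (by omega), hfr₁ _ (by omega) (by omega), hfr _ (by omega), hs l hl]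
  · simp only [Function.update_self]
    rw [h00, h61]
    split <;> simp [*]

/-- Induction on the number `l` of varying columns; `g` records the columns fixed by the outer
loops. Register 0 accumulates the conjunction of the tests as a product. -/
theorem exec_nest (hx : Presents x n m b) (hW : 1 + m * n + n < W) (hmW : m < W)
    (hk : 10 + k + 2 * tableSize k ≤ W) (hm : 0 < m) (hn : 0 < n) (l : ℕ) (hl : l ≤ k)
    (g : ℕ → ℕ) (hg : ∀ i, l ≤ i → i < k → 1 ≤ g i ∧ g i ≤ n) (s : ℕ → ℕ) (hR : Ready F k n m s)
    (hs : ∀ i, l ≤ i → i < k → s (10 + i) = g i) (h0 : s 0 ≤ 1) :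
    Exec x W (.nest k l) (n ^ l * (m * (4 * k + 6) + (4 * k + 7) + 5 * l)) s (fun s' =>
      Ready F k n m s' ∧ (∀ i, l ≤ i → i < k → s' (10 + i) = g i) ∧ s' 0 ≤ 1 ∧
      (s' 0 = 1 ↔ s 0 = 1 ∧ ∀ e : ℕ → ℕ, (∀ i, l ≤ i → i < k → e i = g i) →
        (∀ i < k, 1 ≤ e i ∧ e i ≤ n) → TupleTest F k m b e)) := by
  induction l generalizing g s with
  | zero =>
    refine (exec_tuple hx hW hmW hk hm g (fun i => hg i (by omega)) s hR
      (fun i => hs i (by omega)) h0).mono (by simp) ?_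
    rintro s' ⟨h1, h2, h3, h4⟩
    refine ⟨h1, fun i _ => h2 i, h3, h4.trans (and_congr_right fun _ => ⟨fun h e he _ => ?_,
      fun h => h g (fun _ _ _ => rfl) fun i => hg i (by omega)⟩)⟩
    have : (fun l : Fin k => e l) = fun l : Fin k => g l :=
      funext fun i => he i (by omega) i.2
    have hb : ∀ j, (fun l : Fin k => b j (e l)) = fun l : Fin k => b j (g l) := fun j =>
      funext fun i => congrArg (b j) (congrFun this i)
    simpa only [TupleTest, hb] using h
  | succ l ih =>
    let A := m * (4 * k + 6) + (4 * k + 7) + 5 * l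
    -- The new column runs from `n` down to `1`; at `j`, the tuples with `e l > j` have been tested.
    let Inv : ℕ → (ℕ → ℕ) → Prop := fun j s' =>
      Ready F k n m s' ∧ s' (10 + l) = j ∧ (∀ i, l + 1 ≤ i → i < k → s' (10 + i) = g i) ∧
      s' 0 ≤ 1 ∧ (s' 0 = 1 ↔ s 0 = 1 ∧ ∀ e : ℕ → ℕ, (∀ i, l + 1 ≤ i → i < k → e i = g i) →
        (∀ i < k, 1 ≤ e i ∧ e i ≤ n) → j < e l → TupleTest F k m b e)
    have hbody : ∀ j < n, ∀ s', Inv (j + 1) s' →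
        Exec x W (.nest k l ;; .single (.sub (10 + l) (10 + l) 3) ;;
          .single (.sub 7 3 (10 + l))) (n ^ l * A + 2) s'
          (fun s'' => Inv j s'' ∧ (s'' 7 = 0 ↔ j ≠ 0)) := by
      rintro j hj s' ⟨hR', hcur, hout, h0', hiff⟩
      have hgl : ∀ i, l ≤ i → i < k →
          s' (10 + i) = Function.update g l (j + 1) i := by
        intro i hi hik
        by_cases hil : i = l
        · subst hil
          simpa using hcur
        · rw [Function.update_of_ne hil]
          exact hout i (by omega) hik
      refine (ih (by omega) (Function.update g l (j + 1)) ?_ s' hR' hgl h0').seq ?_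
      · intro i hi hik
        by_cases hil : i = l
        · subst hil
          simp
          omega
        · rw [Function.update_of_ne hil]
          exact hg i (by omega) hik
      rintro s₁ ⟨hR₁, hout₁, h0₁, hiff₁⟩
      refine Exec.seq (t := 1) (t' := 1) (Exec.sub rfl) ?_
      rintro _ rfl
      have ecur : s₁ (10 + l) = j + 1 := by simpa using hout₁ l le_rfl (by omega)
      have e3 := hR₁.one_eq
      refine Exec.sub ⟨⟨hR₁.congr fun r hr => ?_, ?_, fun i hi hik => ?_, ?_, ?_⟩, ?_⟩
      · rw [Function.update_of_ne (by omega), Function.update_of_ne (by omega)]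
      · rw [Function.update_of_ne (by omega)]
        simp [ecur, e3]
      · rw [Function.update_of_ne (by omega), Function.update_of_ne (by omega),
          hout₁ i (by omega) hik, Function.update_of_ne (by omega)]
      · rwa [Function.update_of_ne (by omega), Function.update_of_ne (by omega)]
      · rw [Function.update_of_ne (by omega), Function.update_of_ne (by omega), hiff₁, hiff,
          and_assoc]
        refine and_congr_right fun _ => ⟨fun ⟨h1, h2⟩ e he he' hje => ?_, fun h => ⟨?_, ?_⟩⟩
        · by_cases hel : e l = j + 1
          · refine h2 e (fun i hi hik => ?_) he'
            by_cases hil : i = l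
            · subst hil
              simpa using hel
            · rw [Function.update_of_ne hil]
              exact he i (by omega) hik
          · exact h1 e he he' (by omega)
        · exact fun e he he' hje => h e he he' (by omega)
        · intro e he he'
          refine h e (fun i hi hik => ?_) he' ?_
          · rw [he i (by omega) hik, Function.update_of_ne (by omega)]
          · rw [he l le_rfl (by omega)]
            simp
      · rw [Function.update_self, Function.update_of_ne (by omega), Function.update_self, ecur, e3]
        omega
    refine Exec.mono (t := 1 + (1 + n * (n ^ l * A + 2 + 1))) ?_ ?_ (fun _ h => h)
    · refine Exec.seq (Exec.const (by omega) rfl) ?_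
      rintro _ rfl
      have e1 : (Function.update s 7 0) 1 = n := by simp [hR.n_eq]
      refine Exec.seq (Exec.add (by simp [hR.n_eq]; omega) rfl) ?_
      rintro _ rfl
      refine (Exec.untilNonzero Inv n hbody hn ⟨hR.congr fun r hr => ?_, ?_,
        fun i hi hik => ?_, ?_, ?_⟩).mono le_rfl ?_
      · rw [Function.update_of_ne (by omega), Function.update_of_ne (by omega)]
      · simp [hR.n_eq]
      · rw [Function.update_of_ne (by omega), Function.update_of_ne (by omega), hs i hi hik]
      · rwa [Function.update_of_ne (by omega), Function.update_of_ne (by omega)]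
      · rw [Function.update_of_ne (by omega), Function.update_of_ne (by omega)]
        refine ⟨fun h => ⟨h, fun e _ he hne => ?_⟩, And.left⟩
        have := he l (by omega)
        omega
      · rintro s' ⟨h1, -, h3, h4, h5⟩
        refine ⟨h1, h3, h4, h5.trans (and_congr_right fun _ => ?_)⟩
        refine forall_congr' fun e => forall_congr' fun _ => forall_congr' fun he => ?_
        exact ⟨fun h => h (by have := he l (by omega); omega), fun h _ => h⟩
    -- The overhead of this loop is `3 * n + 2 ≤ 5 * n ^ (l + 1)`, as `n ≥ 1`; hence the summand `5
    -- * l`.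
    · have hpos : n * 1 ≤ n * n ^ l := Nat.mul_le_mul_left _ (Nat.one_le_pow _ _ hn)
      have : n ^ (l + 1) * (m * (4 * k + 6) + (4 * k + 7) + 5 * (l + 1)) =
          n * (n ^ l * A) + 5 * (n * n ^ l) := by
        simp only [A]
        ring
      rw [this]
      have h2 : n * (n ^ l * A + 2 + 1) = n * (n ^ l * A) + 3 * n := by ring
      omega

end Correctness

/-! ### The input of the closure problem -/

namespace ClosureInstance

/-- The matrix with the rows `v, S 0, …, S (m - 1)`, its columns numbered from `1` on. -/
def entry (I : ClosureInstance) (j i : ℕ) : Bool :=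
  if hi : i - 1 < I.n then
    if j = 0 then I.v ⟨i - 1, hi⟩
    else if hj : j - 1 < I.m then I.S ⟨j - 1, hj⟩ ⟨i - 1, hi⟩ else false
  else false

theorem input_eq (I : ClosureInstance) : I.input =
    I.n :: I.m :: ((List.ofFn I.v).map Bool.toNat ++
      (List.ofFn (fun j => (List.ofFn (I.S j)).map Bool.toNat)).flatten) := rfl

theorem length_flatten_rows (I : ClosureInstance) :
    (List.ofFn (fun j => (List.ofFn (I.S j)).map Bool.toNat)).flatten.length = I.m * I.n := by
  simp [List.length_flatten, List.map_ofFn, Function.comp_def]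

theorem length_input (I : ClosureInstance) : I.input.length = 2 + I.n + I.m * I.n := by
  rw [input_eq]
  simp only [List.length_cons, List.length_append, List.length_map, List.length_ofFn,
    length_flatten_rows]
  omega

theorem presents_input (I : ClosureInstance) : Presents I.input I.n I.m I.entry := by
  intro j hj i hi1 hin
  have hlt : i - 1 < I.n := by omega
  rw [input_eq]
  rcases Nat.eq_zero_or_pos j with rfl | hj0
  · rw [show 1 + 0 * I.n + i = (i - 1) + 1 + 1 by omega, List.getD_cons_succ, List.getD_cons_succ,
      List.getD_append _ _ _ _ (by simpa using hlt)]
    simp [entry, hlt]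
  · obtain ⟨j, rfl⟩ : ∃ j', j = j' + 1 := ⟨j - 1, by omega⟩
    have hidx : j * I.n + (i - 1) < I.m * I.n := by
      have : (j + 1) * I.n ≤ I.m * I.n := Nat.mul_le_mul_right _ hj
      rw [Nat.add_mul] at this
      omega
    rw [show 1 + (j + 1) * I.n + i = (I.n + (j * I.n + (i - 1))) + 1 + 1 by
        rw [Nat.add_mul]; omega,
      List.getD_cons_succ, List.getD_cons_succ, List.getD_append_right _ _ _ _ (by simp)]
    -- The flattened rows form one list of length `m * n`, addressed by quotient and remainder
    -- modulo `n`.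
    have hrows : (List.ofFn (fun j => (List.ofFn (I.S j)).map Bool.toNat)).flatten =
        List.ofFn (fun q : Fin (I.m * I.n) => (I.S q.divNat q.modNat).toNat) := by
      rw [List.ofFn_mul]
      congr 2
      funext j
      rw [List.map_ofFn]
      congr 1
      funext i
      have hn : 0 < I.n := i.pos
      have h1 : (j.1 * I.n + i.1) / I.n = j := by
        rw [Nat.mul_comm, Nat.mul_add_div hn, Nat.div_eq_of_lt i.2, Nat.add_zero]
      have h2 : (j.1 * I.n + i.1) % I.n = i := by
        rw [Nat.mul_comm, Nat.mul_add_mod, Nat.mod_eq_of_lt i.2]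
      simp only [Function.comp, Fin.divNat, Fin.modNat, h1, h2]
    have h1 : (j * I.n + (i - 1)) / I.n = j := by
      rw [Nat.mul_comm, Nat.mul_add_div (by omega), Nat.div_eq_of_lt hlt, Nat.add_zero]
    have h2 : (j * I.n + (i - 1)) % I.n = i - 1 := by
      rw [Nat.mul_comm, Nat.mul_add_mod, Nat.mod_eq_of_lt hlt]
    have hjm : j < I.m := by omega
    rw [hrows]
    simp [List.getD_eq_getElem?_getD, hidx, entry, hlt, hjm, Fin.divNat, Fin.modNat, h1, h2]

/-- The tests of all tuples of columns decide the instance. -/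
theorem inClosure_iff (I : ClosureInstance) {k : ℕ} (hk : 2 ≤ k) (hn : 0 < I.n)
    {F : Set (Operation Bool)} (hF : threshold k ∈ F) :
    InClosure F (Set.range I.S) I.v ↔
      ∀ e : ℕ → ℕ, (∀ i < k, 1 ≤ e i ∧ e i ≤ I.n) → TupleTest F k I.m I.entry e := by
  -- Translates between columns numbered from `1`, as in the program, and `Fin I.n`.
  have key : ∀ (e : ℕ → ℕ) (e' : Fin k → Fin I.n), (∀ i : Fin k, e i = e' i + 1) →
      (TupleTest F k I.m I.entry e ↔
        InClosure F ((fun w => w ∘ e') '' Set.range I.S) (I.v ∘ e')) := by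
    intro e e' he
    have hv : (fun l : Fin k => I.entry 0 (e l)) = I.v ∘ e' := by
      funext l
      simp [entry, he]
    have hS : {w | ∃ j, 1 ≤ j ∧ j ≤ I.m ∧ w = fun l : Fin k => I.entry j (e l)} =
        (fun w => w ∘ e') '' Set.range I.S := by
      have hrow : ∀ j (hj : j < I.m),
          (fun l : Fin k => I.entry (j + 1) (e l)) = I.S ⟨j, hj⟩ ∘ e' := by
        intro j hj
        funext l
        simp [entry, he, hj]
      ext w
      simp only [Set.mem_ofPred_eq, Set.mem_image, Set.exists_range_iff]
      constructor
      · rintro ⟨j, h1, h2, rfl⟩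
        obtain ⟨j, rfl⟩ : ∃ j', j = j' + 1 := ⟨j - 1, by omega⟩
        exact ⟨⟨j, h2⟩, (hrow j h2).symm⟩
      · rintro ⟨j, rfl⟩
        exact ⟨j + 1, by omega, j.2, (hrow j j.2).symm⟩
    rw [TupleTest, hv, hS]
  rw [inClosure_iff_forall_tuple hk hn hF]
  constructor
  · intro h e he
    have hb : ∀ i : Fin k, e i - 1 < I.n := fun i => by have := he i i.2; omega
    refine (key e (fun i => ⟨e i - 1, hb i⟩) fun i => ?_).mpr (h _)
    have := he i i.2
    simp only
    omega
  · intro h e'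
    let e : ℕ → ℕ := fun i => if hi : i < k then (e' ⟨i, hi⟩).1 + 1 else 0
    have he : ∀ i : Fin k, e i = e' i + 1 := fun i => by simp [e]
    refine (key e e' he).mp (h e fun i hi => ?_)
    have := (e' ⟨i, hi⟩).2
    rw [he ⟨i, hi⟩]
    omega

end ClosureInstance

/-! ### The complete program: set-up, degenerate cases, time and word size -/

theorem insertTable_lt {k t : ℕ} (ht : t < tableSize k) : insertTable k t < tableSize k := by
  have h1 : t / 2 ^ k < 2 ^ 2 ^ k := (Nat.div_lt_iff_lt_mul (by positivity)).mpr ht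
  have h2 : t % 2 ^ k < 2 ^ k := Nat.mod_lt _ (by positivity)
  exact (Nat.or_lt_two_pow h1 (Nat.pow_lt_pow_right (by omega) h2)).trans_le
    (Nat.le_mul_of_pos_right _ (by positivity))

theorem closureTable_le {F : Set (Operation Bool)} {k t : ℕ} : closureTable F k t ≤ 1 := by
  rw [closureTable]
  split <;> omega

/-- Without generators the answer is no; with generators but `n = 0` it is yes, as there is only one
vector. Otherwise the tables are written, at a cost depending on `k` alone, and the loops run. -/
theorem exec_closure (I : ClosureInstance) {k : ℕ} (hk : 2 ≤ k) {F : Set (Operation Bool)}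
    (hF : threshold k ∈ F) {W : ℕ} (hW : 1 + I.m * I.n + I.n < W) (hmW : I.m < W)
    (hkW : 10 + k + 2 * tableSize k ≤ W) :
    Exec I.input W (.closure F k)
      ((13 * k + 2 * tableSize k + 30) * (I.m * I.n ^ k + 1)) (fun _ => 0) (fun s' =>
        (InClosure F (Set.range I.S) I.v ∧ s' 0 = 1) ∨
          (¬ InClosure F (Set.range I.S) I.v ∧ s' 0 = 0)) := by
  have hM0 : 0 < tableSize k := by rw [tableSize]; positivity
  set M := tableSize k with hM
  refine Exec.mono (t := 1 + (1 + (1 + (1 + ((1 + ((1 + (1 + (M + (M +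
    (13 * k + 13) * (I.m * I.n ^ k))))) + 1)) + 1)))))
    ?_ ?_ (fun _ h => h)
  · have hget0 : I.input.getD 0 0 = I.n := rfl
    have hget1 : I.input.getD 1 0 = I.m := rfl
    refine Exec.seq (Exec.const (by omega) rfl) ?_
    rintro _ rfl
    refine Exec.seq (Exec.read (Q := fun s => s = Function.update (Function.update
      (fun _ => 0) 7 0) 1 I.n) (by simp only [Function.update_self, hget0]; omega)
      (by simp only [Function.update_self, hget0])) ?_
    rintro _ rfl
    refine Exec.seq (Exec.const (by omega) rfl) ?_
    rintro _ rfl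
    refine Exec.seq (Exec.read (Q := fun s => s = Function.update (Function.update
      (Function.update (Function.update (fun _ => 0) 7 0) 1 I.n) 3 1) 2 I.m)
      (by simp only [Function.update_self, hget1]; omega)
      (by simp only [Function.update_self, hget1])) ?_
    rintro _ rfl
    refine Exec.unlessZero (fun hm => .inr ⟨?_, by simp⟩) fun hm => ?_
    · have hm : I.m = 0 := by simpa using hm
      have : IsEmpty (Fin I.m) := by rw [hm]; infer_instance
      rw [Set.range_eq_empty]
      exact not_inClosure_empty
    have hm : 0 < I.m := Nat.pos_of_ne_zero (by simpa using hm)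
    refine Exec.seq (Exec.const (by omega) rfl) ?_
    rintro _ rfl
    refine Exec.unlessZero (fun hn => .inl ⟨?_, by simp⟩) fun hn => ?_
    · have hn : I.n = 0 := by simpa using hn
      have : IsEmpty (Fin I.n) := by rw [hn]; infer_instance
      exact .basic _ ⟨⟨0, hm⟩, Subsingleton.elim _ _⟩
    have hn : 0 < I.n := Nat.pos_of_ne_zero (by simpa using hn)
    refine Exec.seq (Exec.const (by omega) rfl) ?_
    rintro _ rfl
    refine Exec.seq (Exec.const (by omega) rfl) ?_
    rintro _ rfl
    refine Exec.seq (exec_table _ _ _ (fun e he => (insertTable_lt he).trans (by omega)) _) ?_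
    rintro s₁ ⟨hi₁, hfr₁⟩
    refine Exec.seq (exec_table _ _ _ (fun e he => closureTable_le.trans_lt (by omega)) _) ?_
    rintro s₂ ⟨hi₂, hfr₂⟩
    have hfr : ∀ r, r < 10 → s₂ r = _ := fun r hr =>
      (hfr₂ r (by omega)).trans (hfr₁ r (by omega))
    have hR : Ready F k I.n I.m s₂ :=
      { n_eq := by rw [hfr _ (by omega)]; simp
        m_eq := by rw [hfr _ (by omega)]; simp
        one_eq := by rw [hfr _ (by omega)]; simp
        insert_eq := by rw [hfr _ (by omega)]; simp
        closure_eq := by rw [hfr _ (by omega)]; simp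
        insert_table := fun e he => (hfr₂ _ (by omega)).trans (hi₁ e he)
        closure_table := hi₂ }
    have h0 : s₂ 0 = 1 := by rw [hfr _ (by omega)]; simp
    refine (exec_nest I.presents_input hW hmW hkW hm hn k le_rfl (fun _ => 0)
      (fun i _ _ => by omega) s₂ hR (fun i _ _ => by omega) h0.le).mono ?_ ?_
    -- Since `m ≥ 1`, the cost per tuple that does not depend on `m` is absorbed into the factor `13
    -- * k + 13` of `m`.
    · have h1 : (4 * k + 7 + 5 * k) * 1 ≤ (4 * k + 7 + 5 * k) * I.m := Nat.mul_le_mul_left _ hm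
      calc I.n ^ k * (I.m * (4 * k + 6) + (4 * k + 7) + 5 * k)
          ≤ I.n ^ k * ((13 * k + 13) * I.m) := Nat.mul_le_mul_left _ (by linarith)
        _ = (13 * k + 13) * (I.m * I.n ^ k) := by ring
    rintro s' ⟨-, -, hle, hiff⟩
    have hiff' : s' 0 = 1 ↔ InClosure F (Set.range I.S) I.v := by
      rw [hiff, I.inClosure_iff hk hn hF]
      exact ⟨fun h e => h.2 e fun i _ _ => by omega, fun h => ⟨h0, fun e _ => h e⟩⟩
    rw [← hiff']
    omega
  · have h1 : (13 * k + 13) * (I.m * I.n ^ k) ≤ (13 * k + 2 * M + 30) * (I.m * I.n ^ k) :=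
      Nat.mul_le_mul_right _ (by omega)
    rw [Nat.mul_add]
    omega

theorem decidesWithin_of_exec {P : DecisionProblem} {I : P.Instance} {W' t : ℕ} {b : Code}
    (h : Exec (P.input I) (2 ^ W') b t (fun _ => 0) (fun s' =>
      (I ∈ P.Yes ∧ s' 0 = 1) ∨ (I ∉ P.Yes ∧ s' 0 = 0))) :
    DecidesWithin P (b 0) I t W' := by
  obtain ⟨s', hQ, u, hu, hrun, hb⟩ := h (fun _ => by positivity) (b 0) 0
    (fun i _ => by rw [Nat.zero_add])
  refine ⟨u, hu, ?_, ?_, hb⟩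
  · rw [Halted, run, hrun]
    simp
  · rw [run, hrun]
    exact hQ

/-- If `F` contains the threshold function, its closure problem is solvable in time
`O(m * n ^ k)`. -/
theorem solvableInTime_closureProblem {k : ℕ} (hk : 2 ≤ k) {F : Set (Operation Bool)}
    (hF : threshold k ∈ F) :
    SolvableInTime (closureProblem F) (fun I : ClosureInstance => I.m * I.n ^ k) := by
  refine ⟨Code.closure F k 0, 13 * k + 2 * tableSize k + 30, fun I => ?_⟩
  refine decidesWithin_of_exec ?_
  set c := 13 * k + 2 * tableSize k + 30 with hc
  set N := ((closureProblem F).input I).length + ((closureProblem F).input I).sum + 1 with hN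
  have hlen : ((closureProblem F).input I).length = 2 + I.n + I.m * I.n := I.length_input
  have hsum : I.n + (I.m + 0) ≤ ((closureProblem F).input I).sum := by
    change _ ≤ I.input.sum
    rw [I.input_eq, List.sum_cons, List.sum_cons]
    omega
  have hsize : 1 ≤ Nat.size N := Nat.size_pos.mpr (by omega)
  -- The word bound has to exceed both `N`, which bounds input addresses and counters, and `c`,
  -- which bounds the tables and their addresses.
  have h1 : N < 2 ^ (c * Nat.size N) := (Nat.lt_size_self N).trans_le
    (Nat.pow_le_pow_right (by omega) (Nat.le_mul_of_pos_left _ (by omega)))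
  have h2 : c < 2 ^ (c * Nat.size N) := Nat.lt_two_pow_self.trans_le
    (Nat.pow_le_pow_right (by omega) (Nat.le_mul_of_pos_right _ hsize))
  exact exec_closure I hk hF (by omega) (by omega) (by omega)

/-! ### Polynomial time -/

theorem DecidesWithin.mono {P : DecisionProblem} {p : List Instr} {I : P.Instance}
    {t t' w w' : ℕ} (h : DecidesWithin P p I t w) (ht : t ≤ t') (hw : w ≤ w') :
    DecidesWithin P p I t' w' := by
  obtain ⟨s, hs, h1, h2, h3⟩ := h
  exact ⟨s, hs.trans ht, h1, h2, fun s' hs' r =>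
    (h3 s' hs' r).trans_le (Nat.pow_le_pow_right (by omega) hw)⟩

/-- Bounds `log N` by the bit size: a new entry `a` adds `a + 1 ≤ 2 ^ Nat.size a` on the left and
contributes a factor `2 ^ (Nat.size a + 1)` on the right. -/
theorem length_add_sum_lt (x : List ℕ) : x.length + x.sum + 1 ≤ 2 ^ bitSize x := by
  induction x with
  | nil => simp [bitSize]
  | cons a x ih =>
    have ha : a < 2 ^ Nat.size a := Nat.lt_size_self a
    have e : bitSize (a :: x) = Nat.size a + bitSize x + 1 := by
      simp only [bitSize, List.map_cons, List.sum_cons]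
      omega
    have h1 : 1 ≤ 2 ^ Nat.size a := Nat.one_le_two_pow
    have h2 : 1 ≤ 2 ^ bitSize x := Nat.one_le_two_pow
    rw [e, pow_succ, pow_add, List.length_cons, List.sum_cons]
    nlinarith

theorem length_le_bitSize (x : List ℕ) : x.length ≤ bitSize x := by
  induction x with
  | nil => simp
  | cons a x ih =>
    simp only [bitSize, List.map_cons, List.sum_cons, List.length_cons] at ih ⊢
    omega

theorem inP_of_solvableInTime {F : Set (Operation Bool)} {k : ℕ} (hk : 2 ≤ k)
    (h : SolvableInTime (closureProblem F) (fun I : ClosureInstance => I.m * I.n ^ k)) :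
    InP (closureProblem F) := by
  obtain ⟨p, c, h⟩ := h
  refine ⟨p, .C c * (.X ^ (k + 1) + .X + 1), fun I => (h I).mono ?_ ?_⟩
  · simp only [Polynomial.eval_mul, Polynomial.eval_C, Polynomial.eval_add, Polynomial.eval_pow,
      Polynomial.eval_X, Polynomial.eval_one]
    have hB := length_le_bitSize I.input
    change c * (I.m * I.n ^ k + 1) ≤ c * (bitSize I.input ^ (k + 1) + bitSize I.input + 1)
    rw [I.length_input] at hB
    refine Nat.mul_le_mul_left _ ?_
    suffices I.m * I.n ^ k ≤ bitSize I.input ^ (k + 1) by omega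
    obtain ⟨k, rfl⟩ : ∃ k', k = k' + 1 := ⟨k - 1, by omega⟩
    -- Only `m * n` and `n` are bounded by the input length; for `n = 0` the number `m` alone may be
    -- exponential in the bit size.
    calc I.m * I.n ^ (k + 1) = (I.m * I.n) * I.n ^ k := by ring
      _ ≤ bitSize I.input * bitSize I.input ^ k :=
        Nat.mul_le_mul (by omega) (Nat.pow_le_pow_left (by omega) _)
      _ = bitSize I.input ^ (k + 1) := by ring
      _ ≤ bitSize I.input ^ (k + 1 + 1) := Nat.pow_le_pow_right (by omega) (by omega)
  · simp only [Polynomial.eval_mul, Polynomial.eval_C, Polynomial.eval_add, Polynomial.eval_pow,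
      Polynomial.eval_X, Polynomial.eval_one]
    refine Nat.mul_le_mul_left _ ?_
    have : Nat.size (((closureProblem F).input I).length + ((closureProblem F).input I).sum + 1) ≤
        bitSize ((closureProblem F).input I) + 1 :=
      Nat.size_le.mpr ((length_add_sum_lt _).trans_lt (Nat.pow_lt_pow_right (by omega) (by omega)))
    omega

theorem inP_closureProblem {k : ℕ} (hk : 2 ≤ k) {F : Set (Operation Bool)}
    (hF : threshold k ∈ F) : InP (closureProblem F) :=
  inP_of_solvableInTime hk (solvableInTime_closureProblem hk hF)

theorem threshold_two_eq_maj : threshold 2 = maj := by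
  have h : ∀ x : Fin 3 → Bool,
      decide (2 ≤ (Finset.univ.filter (fun i : Fin 3 => x i = true)).card) =
        ((x 0 && x 1) || (x 0 && x 2) || (x 1 && x 2)) := by decide
  simp only [threshold, maj]
  congr 1
  exact funext h

end CloneClosure

theorem mainTheorem8 :
    (∀ (k : ℕ) (F : Set (CloneClosure.Operation Bool)), 2 ≤ k → CloneClosure.IsClone F →
      CloneClosure.threshold k ∈ F →
      CloneClosure.SolvableInTime (CloneClosure.closureProblem F)
        (fun I : CloneClosure.ClosureInstance => I.m * I.n ^ k)) ∧
    (∀ k : ℕ, 2 ≤ k →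
      CloneClosure.InP (CloneClosure.closureProblem (CloneClosure.S10 k)) ∧
      CloneClosure.InP (CloneClosure.closureProblem (CloneClosure.S12 k))) ∧
    CloneClosure.InP (CloneClosure.closureProblem CloneClosure.D1) := by
  refine ⟨fun k F hk _ hF => CloneClosure.solvableInTime_closureProblem hk hF,
    fun k hk => ⟨CloneClosure.inP_closureProblem hk (.basic _ (Set.mem_insert _ _)),
      CloneClosure.inP_closureProblem hk (.basic _ (Set.mem_insert _ _))⟩,
    CloneClosure.inP_closureProblem le_rfl ?_⟩
  rw [CloneClosure.threshold_two_eq_maj]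
  exact .basic _ (Set.mem_insert _ _)
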